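/- An infinite binary word is a sequence $\mathbf w=\mathbf w[0]\mathbf w[1]\mathbf w[2]\cdots$ with letters in $\{0,1\}$. It is overlap-free if it has no factor (block of consecutive letters) of the form $axaxa$, where $a$ is a letter and $x$ is a possibly empty finite word. Let $\mathbf t=01101001\cdots$ be the Thue–Morse word, whose letter $\mathbf t[n]$ is the number, modulo $2$, of ones in the binary representation of $n$, and let $\overline{\mathbf t}$ be its complement, $\overline{\mathbf t}[n]=1-\mathbf t[n]$. For infinite words $\mathbf x,\mathbf y$ define the lower and upper similarity densities $$\mathrm{LSD}(\mathbf x,\mathbf y)=\liminf_{n\to\infty}\frac1n\,\bigl|\{0\le i<n:\mathbf x[i]=\mathbf y[i]\}\bigr|,\qquad \mathrm{USD}(\mathbf x,\mathbf y)=\limsup_{n\to\infty}\frac1n\,\bigl|\{0\le i<n:\mathbf x[i]=\mathbf y[i]\}\bigr|.$$ **Theorem.** (1) For every overlap-free infinite binary word $\mathbf w\notin\{\mathbf t,\overline{\mathbf t}\}$, $$\tfrac14\le \mathrm{LSD}(\mathbf w,\mathbf t)\le \mathrm{USD}(\mathbf w,\mathbf t)\le\tfrac34 .$$ (2) Consequently,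 if $A\subseteq\mathbb N=\{0,1,2,\dots\}$ is an infinite set of natural density $0$, i.e. $\lim_{n\to\infty}\frac1n|A\cap\{0,\dots,n-1\}|=0$, then the word obtained from $\mathbf t$ by replacing $\mathbf t[n]$ by $1-\mathbf t[n]$ for every $n\in A$ (and leaving the other letters unchanged) is not overlap-free. -/

import Mathlib

namespace InfWord

/-- A finite word `u` is a factor of the infinite word `w` if it occurs in `w` at some position. -/
def IsFactor {α : Type*} (u : List α) (w : ℕ → α) : Prop :=
  ∃ i : ℕ, u = List.ofFn (fun j : Fin u.length => w (i + j))

/-- `w` is overlap-free if it contains no factor of the form `a x a x a`, where `a` is a letter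
and `x` is a (possibly empty) finite word. -/
def OverlapFree {α : Type*} (w : ℕ → α) : Prop :=
  ¬ ∃ (a : α) (x : List α), IsFactor ([a] ++ x ++ [a] ++ x ++ [a]) w

/-- The Thue-Morse word: its letter in position `n` is the number, modulo 2, of ones in the binary
representation of `n`. -/
def thueMorse (n : ℕ) : Fin 2 := Fin.ofNat 2 ((Nat.digits 2 n).count 1)

/-- The binary complement of an infinite binary word. -/
def complement (w : ℕ → Fin 2) : ℕ → Fin 2 := fun n => 1 - w n

open Classical in
/-- The word obtained from `w` by flipping the letters in the positions that belong to `A`. -/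
noncomputable def flipOn (A : Set ℕ) (w : ℕ → Fin 2) : ℕ → Fin 2 :=
  fun n => if n ∈ A then 1 - w n else w n

/-- The prefix of length `n` of an infinite word. -/
def take {α : Type*} (w : ℕ → α) (n : ℕ) : Fin n → α := fun i => w i

/-- The similarity density of two finite words of the same length `n` (meaningful for `0 < n`). -/
noncomputable def SD {α : Type*} [DecidableEq α] {n : ℕ} (x y : Fin n → α) : ℝ :=
  (1 / (n : ℝ)) * ∑ i : Fin n, if x i = y i then (1 : ℝ) else 0

/-- The lower similarity density of two infinite words. -/
noncomputable def LSD {α : Type*} [DecidableEq α] (x y : ℕ → α) : ℝ :=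
  Filter.liminf (fun n : ℕ => SD (take x n) (take y n)) Filter.atTop

/-- The upper similarity density of two infinite words. -/
noncomputable def USD {α : Type*} [DecidableEq α] (x y : ℕ → α) : ℝ :=
  Filter.limsup (fun n : ℕ => SD (take x n) (take y n)) Filter.atTop

/-- The set `A` of natural numbers has natural (asymptotic) density `d`. -/
def HasDensity (A : Set ℕ) (d : ℝ) : Prop :=
  Filter.Tendsto (fun n : ℕ => ((A ∩ Set.Iio n).ncard : ℝ) / (n : ℝ)) Filter.atTop (nhds d)

end InfWord

/-!
Let `μ` be the Thue–Morse morphism `0 ↦ 01`, `1 ↦ 10`, and `t` the Thue–Morse word, so `t = μ(t)`.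
Every overlap-free word can be written `w = x μ(v)` with `v` overlap-free and `x` empty, a letter or
the square of a letter (`OverlapFree.exists_isExt`), because after position `0` all squares of
letters start at positions of one parity. Compare `w = x μ(v)` with `t` shifted by `k`.

* If `|x| + k` is odd, the blocks of `μ(v)` straddle those of `t = μ(t)`. A block of `μ(v)` facing
  the end of `μ(a)` and the start of `μ(b)` with `a ≠ b` has exactly one agreement, and this happens
  at least for every other block: the densities lie between `1/4` and `3/4`
  (`IsExt.balanced_odd`).
* If `|x| + k` is even, the blocks are aligned and the densities are those of `v` compared with `t`
  shifted by `(|x| + k) / 2` (`IsExt.balanced_even`).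

Starting from `k = 0` and iterating, the shift stays in `{0, 1}`. If the odd case never occurs, then
either all the removed prefixes are empty and `w` is `t` or its complement, or some prefix has
length `2` and all later ones have length `1`. In the latter case overlap-freeness forces the
sequence of removed letters to be constant or eventually alternating. If it is constant, the word
after the prefix of length `2` is `μ` of the shifted Thue–Morse word or of its complement, and there
is an overlap (`OverlapFree.not_shift`). If it alternates, agreement and disagreement alternate on
blocks whose lengths double, and the densities lie between `1/3` and `2/3`
(`matchCount_alternating`).

For the second part, flipping `t` on a set of density `0` gives a word that agrees with `t` with
density `1`, while it is neither `t` nor its complement.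
-/

namespace InfWord

/-! ### Overlaps -/

theorem isFactor_iff {α : Type*} (u : List α) (w : ℕ → α) :
    IsFactor u w ↔ ∃ i, ∀ j (h : j < u.length), u[j] = w (i + j) := by
  refine exists_congr fun i => ⟨fun h j hj => ?_, fun h => ?_⟩
  · have h2 := List.getElem_of_eq h hj
    simpa using h2
  · refine List.ext_getElem (by simp) fun j h1 h2 => ?_
    simp [h j h1]

/-- An overlap with period `p` at position `i` is a block of length `2 * p + 1` with period `p`. -/
theorem overlapFree_iff {α : Type*} (w : ℕ → α) :
    OverlapFree w ↔ ∀ i p, 0 < p → ∃ j ≤ p, w (i + j) ≠ w (i + j + p) := by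
  constructor
  · intro h i p hp
    by_contra! hc
    obtain ⟨q, rfl⟩ : ∃ q, p = q + 1 := ⟨p - 1, by omega⟩
    refine h ⟨w i, List.ofFn fun j : Fin q => w (i + 1 + j), (isFactor_iff _ _).2 ⟨i, ?_⟩⟩
    intro j hj
    simp only [List.length_append, List.length_cons, List.length_nil, List.length_ofFn] at hj
    have key : ∀ j ≤ q, ([w i] ++ List.ofFn fun j : Fin q => w (i + 1 + j))[j]? = some (w (i + j)) := by
      intro j hj
      rcases j with _ | j
      · simp
      · have : j < q := by omega
        simp [this, add_assoc, add_comm 1 j]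
    apply Option.some_injective
    rw [← List.getElem?_eq_getElem]
    set b := [w i] ++ List.ofFn fun j : Fin q => w (i + 1 + j) with hb
    have hbl : b.length = q + 1 := by simp [hb, add_comm]
    rw [show b ++ [w i] ++ (List.ofFn fun j : Fin q => w (i + 1 + j)) ++ [w i] = b ++ (b ++ [w i]) by
      simp [hb]]
    by_cases h1 : j < q + 1
    · rw [List.getElem?_append_left (by omega), key j (by omega)]
    · rw [List.getElem?_append_right (by omega), hbl]
      obtain ⟨m, rfl⟩ : ∃ m, j = m + (q + 1) := ⟨j - (q + 1), by omega⟩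
      rw [Nat.add_sub_cancel, ← add_assoc, ← hc m (by omega)]
      by_cases h2 : m < q + 1
      · rw [List.getElem?_append_left (by omega), key m (by omega)]
      · rw [List.getElem?_append_right (by omega), hbl]
        have hm : m = q + 1 := by omega
        subst hm
        have := hc 0 (by omega)
        simp at this
        simp [this]
  · rintro h ⟨a, x, hx⟩
    obtain ⟨i, hi⟩ := (isFactor_iff _ _).1 hx
    obtain ⟨j, hj, hne⟩ := h i (x.length + 1) (by omega)
    apply hne
    have h1 := hi j (by simp; omega)
    have h2 := hi (j + (x.length + 1)) (by simp; omega)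
    rw [add_assoc, ← h1, ← h2]
    apply Option.some_injective
    rw [← List.getElem?_eq_getElem, ← List.getElem?_eq_getElem]
    rw [show [a] ++ x ++ [a] ++ x ++ [a] = ([a] ++ x) ++ (([a] ++ x) ++ [a]) by simp]
    have hb : ([a] ++ x)[0]? = some a := rfl
    have hbl : ([a] ++ x).length = x.length + 1 := by simp
    generalize [a] ++ x = b at hb hbl ⊢
    rw [← hbl] at hj ⊢
    rw [List.getElem?_append_right (Nat.le_add_left _ _), Nat.add_sub_cancel]
    rcases hj.lt_or_eq with h3 | rfl
    · rw [List.getElem?_append_left h3, List.getElem?_append_left h3]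
    · rw [List.getElem?_append_right le_rfl, List.getElem?_append_right le_rfl, Nat.sub_self,
        List.getElem?_append_left (by omega), hb]
      rfl

/-! ### The Thue–Morse word -/

theorem thueMorse_zero : thueMorse 0 = 0 := by simp [thueMorse]

theorem thueMorse_two_mul (n : ℕ) : thueMorse (2 * n) = thueMorse n := by
  rcases Nat.eq_zero_or_pos n with rfl | h
  · rfl
  · have := Nat.digits_add 2 (by norm_num) 0 n (by norm_num) (Or.inr h.ne')
    simp only [zero_add] at this
    simp [thueMorse, this]

theorem thueMorse_two_mul_add_one (n : ℕ) : thueMorse (2 * n + 1) = 1 - thueMorse n := by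
  have := Nat.digits_add 2 (by norm_num) 1 n (by norm_num) (Or.inl (by norm_num))
  rw [add_comm] at this
  simp only [thueMorse, this, List.count_cons_self]
  have h2 : ∀ a : Fin 2, a + 1 = 1 - a := by decide
  rw [← h2]
  ext
  simp [Fin.val_add, Fin.ofNat]

/-! ### Desubstitution of overlap-free words -/

/-- `IsExt e w v` says that `w` consists of `e` letters followed by the image of `v` under the
Thue–Morse morphism `0 ↦ 01`, `1 ↦ 10`. -/
def IsExt (e : ℕ) (w v : ℕ → Fin 2) : Prop :=
  ∀ i, w (e + 2 * i) = v i ∧ w (e + 2 * i + 1) = 1 - v i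

theorem IsExt.overlapFree {e : ℕ} {w v : ℕ → Fin 2} (h : IsExt e w v) (hw : OverlapFree w) :
    OverlapFree v := by
  rw [overlapFree_iff] at hw ⊢
  intro i p hp
  by_contra! hc
  obtain ⟨j, hj, hne⟩ := hw (e + 2 * i) (2 * p) (by omega)
  obtain ⟨m, rfl | rfl⟩ : ∃ m, j = 2 * m ∨ j = 2 * m + 1 := ⟨j / 2, by omega⟩
  · apply hne
    rw [show e + 2 * i + 2 * m = e + 2 * (i + m) by ring,
      show e + 2 * (i + m) + 2 * p = e + 2 * (i + m + p) by ring, (h _).1, (h _).1,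
      hc m (by omega)]
  · apply hne
    rw [show e + 2 * i + (2 * m + 1) = e + 2 * (i + m) + 1 by ring,
      show e + 2 * (i + m) + 1 + 2 * p = e + 2 * (i + m + p) + 1 by ring, (h _).2, (h _).2,
      hc m (by omega)]

/-- After a square `aa` at a position `n + 1`, the next square of a letter starts two or four
positions later. -/
theorem OverlapFree.next_square {w : ℕ → Fin 2} (hw : OverlapFree w) (n : ℕ)
    (h : w (n + 1) = w (n + 2)) :
    w (n + 2) ≠ w (n + 3) ∧ w (n + 4) ≠ w (n + 5) ∧
      (w (n + 3) = w (n + 4) ∨ w (n + 5) = w (n + 6)) := by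
  rw [overlapFree_iff] at hw
  have h1 : ∀ k, ¬ (w k = w (k + 1) ∧ w (k + 1) = w (k + 2)) := by
    rintro k ⟨ha, hb⟩
    obtain ⟨j, hj, hne⟩ := hw k 1 (by omega)
    interval_cases j <;> simp_all
  have h2 : ¬ (w (n + 2) = w (n + 4) ∧ w (n + 3) = w (n + 5) ∧ w (n + 4) = w (n + 6)) := by
    rintro ⟨ha, hb, hc⟩
    obtain ⟨j, hj, hne⟩ := hw (n + 2) 2 (by omega)
    interval_cases j <;> simp_all
  have h3 : ¬ (w n = w (n + 3) ∧ w (n + 1) = w (n + 4) ∧ w (n + 2) = w (n + 5) ∧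
      w (n + 3) = w (n + 6)) := by
    rintro ⟨ha, hb, hc, hd⟩
    obtain ⟨j, hj, hne⟩ := hw n 3 (by omega)
    interval_cases j <;> simp_all
  have e0 := h1 n
  have e1 := h1 (n + 1)
  have e3 := h1 (n + 3)
  have e4 := h1 (n + 4)
  simp only [add_assoc, Nat.reduceAdd] at e0 e1 e3 e4
  revert h e0 e1 e3 e4 h2 h3
  clear h1 hw
  generalize w n = a0
  generalize w (n + 1) = a1
  generalize w (n + 2) = a2
  generalize w (n + 3) = a3
  generalize w (n + 4) = a4
  generalize w (n + 5) = a5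
  generalize w (n + 6) = a6
  revert a0 a1 a2 a3 a4 a5 a6
  decide

/-- The squares of letters at positive positions all start at positions of the same parity. -/
theorem OverlapFree.square_parity {w : ℕ → Fin 2} (hw : OverlapFree w) (m n : ℕ)
    (h : w (n + 1) = w (n + 2)) : w (n + 2 * m + 2) ≠ w (n + 2 * m + 3) := by
  induction m using Nat.strong_induction_on generalizing n with
  | _ m ih =>
    obtain ⟨h1, h2, h3⟩ := hw.next_square n h
    rcases m with _ | _ | m
    · exact h1
    · exact h2
    · rcases h3 with h3 | h3
      · have := ih (m + 1) (by omega) (n + 2) h3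
        rwa [show n + 2 + 2 * (m + 1) = n + 2 * (m + 1 + 1) by ring] at this
      · have := ih m (by omega) (n + 4) h3
        rwa [show n + 4 + 2 * m = n + 2 * (m + 1 + 1) by ring] at this

/-- Every overlap-free word is `x μ(v)` with `v` overlap-free, `μ` the Thue–Morse morphism and
`x` one of the empty word, a letter, or the square of a letter. -/
theorem OverlapFree.exists_isExt {w : ℕ → Fin 2} (hw : OverlapFree w) :
    ∃ e v, OverlapFree v ∧ IsExt e w v ∧ (e = 0 ∨ e = 1 ∨ e = 2 ∧ w 0 = w 1) := by
  have ext_of : ∀ e, (∀ i, w (e + 2 * i) ≠ w (e + 2 * i + 1)) →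
      IsExt e w (fun i => w (e + 2 * i)) := by
    intro e he i
    have : ∀ a b : Fin 2, a ≠ b → b = 1 - a := by decide
    exact ⟨rfl, this _ _ (he i)⟩
  have split : (∀ i, w (1 + 2 * i) ≠ w (1 + 2 * i + 1)) ∨ ∀ i, w (2 + 2 * i) ≠ w (2 + 2 * i + 1) := by
    by_contra! hc
    obtain ⟨⟨i, hi⟩, j, hj⟩ := hc
    rcases le_total i j with hij | hij
    · obtain ⟨m, rfl⟩ := Nat.exists_eq_add_of_le hij
      refine hw.square_parity m (2 * i) ?_ ?_
      · convert hi using 2 <;> ring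
      · convert hj using 2 <;> ring
    · obtain ⟨m, rfl⟩ := Nat.exists_eq_add_of_le hij
      rcases m with _ | m
      · refine hw.square_parity 0 (2 * j) ?_ ?_
        · convert hi using 2 <;> ring
        · convert hj using 2 <;> ring
      · refine hw.square_parity m (2 * j + 1) ?_ ?_
        · convert hj using 2 <;> ring
        · convert hi using 2 <;> ring
  rcases split with h | h
  · exact ⟨1, _, (ext_of 1 h).overlapFree hw, ext_of 1 h, by simp⟩
  · by_cases h0 : w 0 = w 1
    · exact ⟨2, _, (ext_of 2 h).overlapFree hw, ext_of 2 h, by simp [h0]⟩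
    · have h' : ∀ i, w (0 + 2 * i) ≠ w (0 + 2 * i + 1) := by
        intro i
        rcases i with _ | i
        · simpa using h0
        · have := h i
          rwa [show 0 + 2 * (i + 1) = 2 + 2 * i by ring]
      exact ⟨0, _, (ext_of 0 h').overlapFree hw, ext_of 0 h', by simp⟩

/-! ### Counting agreements -/

/-- The number of positions `i < n` in which `w` agrees with the Thue–Morse word shifted by `k`. -/
def matchCount (k : ℕ) (w : ℕ → Fin 2) (n : ℕ) : ℕ :=
  ∑ i ∈ Finset.range n, if w i = thueMorse (i + k) then 1 else 0

/-- Up to a bounded error, `w` agrees with the Thue–Morse word shifted by `k` in at least a quarter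
and at most three quarters of the positions of each prefix. -/
def Balanced (k : ℕ) (w : ℕ → Fin 2) : Prop :=
  ∃ C, ∀ n, n ≤ 4 * matchCount k w n + C ∧ 4 * matchCount k w n ≤ 3 * n + C

theorem matchCount_succ (k : ℕ) (w : ℕ → Fin 2) (n : ℕ) :
    matchCount k w (n + 1) = matchCount k w n + if w n = thueMorse (n + k) then 1 else 0 :=
  Finset.sum_range_succ _ _

theorem matchCount_zero (k : ℕ) (w : ℕ → Fin 2) : matchCount k w 0 = 0 := rfl

theorem matchCount_add_le (k : ℕ) (w : ℕ → Fin 2) (n r : ℕ) :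
    matchCount k w n ≤ matchCount k w (n + r) ∧
      matchCount k w (n + r) ≤ matchCount k w n + r := by
  induction r with
  | zero => simp
  | succ r ih =>
    rw [← add_assoc, matchCount_succ]
    split_ifs <;> omega

/-- It suffices to control the agreements along an arithmetic progression of prefix lengths. -/
theorem balanced_of_progression {k : ℕ} {w : ℕ → Fin 2} (e d C : ℕ) (hd : 0 < d)
    (h : ∀ m, d * m ≤ 4 * matchCount k w (e + d * m) + C ∧
      4 * matchCount k w (e + d * m) ≤ 3 * (d * m) + C) : Balanced k w := by
  refine ⟨C + 4 * e + 4 * d, fun n => ?_⟩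
  rcases le_total n e with hn | hn
  · have := matchCount_add_le k w 0 n
    rw [matchCount_zero, zero_add] at this
    omega
  · obtain ⟨n, rfl⟩ := Nat.exists_eq_add_of_le hn
    have h1 := Nat.div_add_mod n d
    have h2 := Nat.mod_lt n hd
    have h3 := matchCount_add_le k w (e + d * (n / d)) (n % d)
    have h4 := h (n / d)
    rw [add_assoc, h1] at h3
    generalize d * (n / d) = q at *
    omega

theorem IsExt.matchCount_even {e : ℕ} {w v : ℕ → Fin 2} (h : IsExt e w v) {k m : ℕ}
    (hk : e + k = 2 * m) (n : ℕ) :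
    matchCount k w (e + 2 * n) = matchCount k w e + 2 * matchCount m v n := by
  induction n with
  | zero => simp [matchCount_zero]
  | succ n ih =>
    rw [show e + 2 * (n + 1) = e + 2 * n + 1 + 1 by ring, matchCount_succ, matchCount_succ,
      matchCount_succ, ih, (h n).1, (h n).2, show e + 2 * n + k = 2 * (n + m) by omega,
      show e + 2 * n + 1 + k = 2 * (n + m) + 1 by omega, thueMorse_two_mul,
      thueMorse_two_mul_add_one]
    have h2 : ∀ a b : Fin 2, (1 - a = 1 - b) ↔ a = b := by decide
    simp only [h2]
    split_ifs <;> ring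

/-- When the blocks of `μ(v)` are aligned with those of the Thue–Morse word, agreements of `w`
come in pairs from agreements of `v`. -/
theorem IsExt.balanced_even {e : ℕ} {w v : ℕ → Fin 2} (h : IsExt e w v) {k m : ℕ}
    (hk : e + k = 2 * m) (hv : Balanced m v) : Balanced k w := by
  obtain ⟨C, hC⟩ := hv
  refine balanced_of_progression e 2 (2 * C + 4 * e) (by norm_num) fun n => ?_
  have h1 := h.matchCount_even hk n
  have h2 := hC n
  have h3 := matchCount_add_le k w 0 e
  rw [matchCount_zero, zero_add] at h3
  omega

/-- When the blocks of `μ(v)` straddle those of the Thue–Morse word `t`, every block facing two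
consecutive blocks of `t` that come from distinct letters contains exactly one agreement. Of two
consecutive blocks at least one is of this kind, as `t` contains no cube of a letter. -/
theorem IsExt.balanced_odd {e : ℕ} {w v : ℕ → Fin 2} (h : IsExt e w v) {k m : ℕ}
    (hk : e + k = 2 * m + 1) : Balanced k w := by
  have step : ∀ n, matchCount k w (e + 2 * (n + 1)) = matchCount k w (e + 2 * n) +
      ((if v n ≠ thueMorse (n + m) then 1 else 0) +
        if v n ≠ thueMorse (n + m + 1) then 1 else 0) := by
    intro n
    rw [show e + 2 * (n + 1) = e + 2 * n + 1 + 1 by ring, matchCount_succ, matchCount_succ,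
      (h n).1, (h n).2, show e + 2 * n + k = 2 * (n + m) + 1 by omega,
      show e + 2 * n + 1 + k = 2 * (n + m + 1) by omega, thueMorse_two_mul,
      thueMorse_two_mul_add_one, add_assoc]
    generalize v n = a
    generalize thueMorse (n + m) = b
    generalize thueMorse (n + m + 1) = c
    congr 1
    revert a b c
    decide
  have distinct : ∀ i, ¬ (thueMorse i = thueMorse (i + 1) ∧ thueMorse (i + 1) = thueMorse (i + 2)) := by
    rintro i ⟨h1, h2⟩
    have h3 : ∀ a : Fin 2, a ≠ 1 - a := by decide
    obtain ⟨j, rfl | rfl⟩ : ∃ j, i = 2 * j ∨ i = 2 * j + 1 := ⟨i / 2, by omega⟩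
    · rw [thueMorse_two_mul, thueMorse_two_mul_add_one] at h1
      exact h3 _ h1
    · rw [show 2 * j + 1 + 1 = 2 * (j + 1) by ring, show 2 * j + 1 + 2 = 2 * (j + 1) + 1 by ring,
        thueMorse_two_mul, thueMorse_two_mul_add_one] at h2
      exact h3 _ h2
  have step2 : ∀ n, matchCount k w (e + 4 * n) + 1 ≤ matchCount k w (e + 4 * (n + 1)) ∧
      matchCount k w (e + 4 * (n + 1)) ≤ matchCount k w (e + 4 * n) + 3 := by
    intro n
    have h1 := step (2 * n)
    have h2 := step (2 * n + 1)
    have h3 := distinct (2 * n + m)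
    rw [show e + 4 * (n + 1) = e + 2 * (2 * n + 1 + 1) by ring, h2, h1,
      show e + 4 * n = e + 2 * (2 * n) by ring, show 2 * n + 1 + m = 2 * n + m + 1 by ring]
    rw [add_assoc (matchCount _ _ _)]
    have : ∀ a b x y z : Fin 2, ¬ (x = y ∧ y = z) →
        1 ≤ ((if a ≠ x then 1 else 0) + if a ≠ y then 1 else 0) +
          ((if b ≠ y then 1 else 0) + if b ≠ z then 1 else 0) ∧
        ((if a ≠ x then 1 else 0) + if a ≠ y then 1 else 0) +
          ((if b ≠ y then 1 else 0) + if b ≠ z then 1 else 0) ≤ 3 := by decide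
    have := this (v (2 * n)) (v (2 * n + 1)) _ _ _ h3
    exact ⟨Nat.add_le_add_left this.1 _, Nat.add_le_add_left this.2 _⟩
  refine balanced_of_progression e 4 (4 * e) (by norm_num) fun n => ?_
  induction n with
  | zero =>
    have h3 := matchCount_add_le k w 0 e
    rw [matchCount_zero, zero_add] at h3
    simp only [mul_zero, add_zero]
    omega
  | succ n ih =>
    have := step2 n
    omega

/-! ### Comparison with the shifted Thue–Morse word -/

/-- If the first letters of `u j`, where `u j` is a letter followed by `μ(u (j + 1))`, alternate,
then agreement and disagreement with the shifted Thue–Morse word alternate on blocks of lengths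
`1, 2, 4, …`. The sharper bound when the first letter of `u j` agrees is what makes the induction
close. -/
theorem matchCount_alternating (u : ℕ → ℕ → Fin 2) (hu : ∀ j, IsExt 1 (u j) (u (j + 1)))
    (halt : ∀ j, u j 0 ≠ u (j + 1) 0) (n : ℕ) : ∀ j,
      (u j 0 = 1 → n ≤ 3 * matchCount 1 (u j) n ∧ 3 * matchCount 1 (u j) n ≤ 2 * n + 1) ∧
      (u j 0 = 0 → n ≤ 3 * matchCount 1 (u j) n + 1 ∧ 3 * matchCount 1 (u j) n ≤ 2 * n) := by
  induction n using Nat.strong_induction_on with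
  | _ n ih =>
    intro j
    rcases Nat.eq_zero_or_pos n with rfl | hn
    · simp [matchCount_zero]
    have ht : thueMorse 1 = 1 := by simp [thueMorse]
    have h1 : matchCount 1 (u j) 1 = if u j 0 = 1 then 1 else 0 := by
      simpa [matchCount_zero, ht] using matchCount_succ 1 (u j) 0
    have hne := halt j
    have hval : ∀ a b : Fin 2, a ≠ b → a = 0 ∧ b = 1 ∨ a = 1 ∧ b = 0 := by decide
    have hev := (hu j).matchCount_even (k := 1) (m := 1) (by norm_num)
    obtain ⟨m, rfl | rfl⟩ : ∃ m, n = 1 + 2 * m ∨ n = 1 + 2 * m + 1 := ⟨(n - 1) / 2, by omega⟩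
    · have hm := ih m (by omega) (j + 1)
      rw [hev, h1]
      rcases hval _ _ hne with ⟨ha, hb⟩ | ⟨ha, hb⟩ <;> simp [ha, hb] at hm ⊢ <;> omega
    · have hm := ih m (by omega) (j + 1)
      have hm' := ih (m + 1) (by omega) (j + 1)
      rw [matchCount_succ] at hm'
      -- The first half of a block of `μ` agrees exactly when the whole block does.
      rw [matchCount_succ, hev, h1, (hu j m).1, show 1 + 2 * m + 1 = 2 * (m + 1) by ring,
        thueMorse_two_mul]
      rcases hval _ _ hne with ⟨ha, hb⟩ | ⟨ha, hb⟩ <;> simp [ha, hb] at hm hm' ⊢ <;>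
        split_ifs at hm' ⊢ <;> omega

/-- Once the first letters of two successive desubstituted words differ, they differ at the next
level too: otherwise `w` starts with an overlap `b a b a b`. Hence a sequence of first letters is
constant or alternates from some level on. -/
theorem OverlapFree.first_letters {w v x : ℕ → Fin 2} (hw : OverlapFree w) (h : IsExt 1 w v)
    (h' : IsExt 1 v x) (hne : w 0 ≠ v 0) : v 0 ≠ x 0 := by
  intro heq
  obtain ⟨j, hj, hc⟩ := (overlapFree_iff w).1 hw 0 2 (by norm_num)
  have e1 := h 0
  have e2 := h 1
  have e3 := h' 0
  norm_num at e1 e2 e3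
  have : ∀ a b : Fin 2, a ≠ b → a = 1 - b := by decide
  have h0 := this _ _ hne
  interval_cases j <;> simp_all

/-- Desubstituting `v` repeatedly, either a misaligned decomposition occurs, or the sequence of
first letters is eventually alternating, or it is constant and `v` is the shifted Thue–Morse word
or its complement. -/
theorem OverlapFree.balanced_one_or {v : ℕ → Fin 2} (hv : OverlapFree v) :
    Balanced 1 v ∨ ∀ n, v n = v 0 + 1 + thueMorse (n + 1) := by
  by_contra! hc
  obtain ⟨hb, n, hn⟩ := hc
  have next : ∀ x : {x : ℕ → Fin 2 // OverlapFree x ∧ ¬ Balanced 1 x},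
      ∃ y : {x : ℕ → Fin 2 // OverlapFree x ∧ ¬ Balanced 1 x}, IsExt 1 x.1 y.1 := by
    rintro ⟨x, hx, hxb⟩
    obtain ⟨e, y, hy, hext, rfl | rfl | ⟨rfl, -⟩⟩ := hx.exists_isExt
    · exact absurd (hext.balanced_odd (m := 0) (by norm_num)) hxb
    · exact ⟨⟨y, hy, fun h => hxb (hext.balanced_even (by norm_num) h)⟩, hext⟩
    · exact absurd (hext.balanced_odd (m := 1) (by norm_num)) hxb
  choose f hf using next
  let u : ℕ → {x : ℕ → Fin 2 // OverlapFree x ∧ ¬ Balanced 1 x} := fun j => f^[j] ⟨v, hv, hb⟩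
  have hu : ∀ j, IsExt 1 (u j).1 (u (j + 1)).1 := by
    intro j
    simp only [u, Function.iterate_succ_apply']
    exact hf _
  have heq : ∀ j, (u j).1 0 = (u (j + 1)).1 0 := by
    intro j
    by_contra hne
    have halt : ∀ i, (u (j + i)).1 0 ≠ (u (j + i + 1)).1 0 := by
      intro i
      induction i with
      | zero => exact hne
      | succ i ih => exact (u (j + i)).2.1.first_letters (hu _) (hu _) ih
    have hM := fun n => matchCount_alternating (fun i => (u (j + i)).1) (fun i => hu (j + i)) halt n 0
    refine (u j).2.2 ⟨2, fun n => ?_⟩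
    have h2 : ∀ a : Fin 2, a = 0 ∨ a = 1 := by decide
    have := hM n
    simp only [add_zero] at this
    rcases h2 ((u j).1 0) with h | h <;> simp [h] at this <;> omega
  have hall : ∀ n j, (u j).1 n = (u j).1 0 + 1 + thueMorse (n + 1) := by
    intro n
    induction n using Nat.strong_induction_on with
    | _ n ih =>
      intro j
      obtain rfl | ⟨m, rfl | rfl⟩ : n = 0 ∨ ∃ m, n = 1 + 2 * m ∨ n = 1 + 2 * m + 1 := by
        rcases Nat.eq_zero_or_pos n with h | h
        · exact Or.inl h
        · exact Or.inr ⟨(n - 1) / 2, by omega⟩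
      · have ht : thueMorse 1 = 1 := by simp [thueMorse]
        have : ∀ a : Fin 2, a = a + 1 + 1 := by decide
        rw [zero_add, ht]
        exact this _
      · rw [(hu j m).1, ih m (by omega), ← heq, show 1 + 2 * m + 1 = 2 * (m + 1) by ring,
          thueMorse_two_mul]
      · rw [(hu j m).2, ih m (by omega), ← heq,
          show 1 + 2 * m + 1 + 1 = 2 * (m + 1) + 1 by ring, thueMorse_two_mul_add_one]
        have : ∀ a b : Fin 2, 1 - (a + 1 + b) = a + 1 + (1 - b) := by decide
        exact this _ _
  exact hn (hall n 0)

/-! ### Comparison with the Thue–Morse word -/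

/-- A square of a letter cannot precede `μ` of the shifted Thue–Morse word or of its complement. -/
theorem OverlapFree.not_shift {w v : ℕ → Fin 2} (hw : OverlapFree w) (h : IsExt 2 w v)
    (h01 : w 0 = w 1) : ¬ ∀ n, v n = v 0 + 1 + thueMorse (n + 1) := by
  intro hv
  obtain ⟨i, hi, hi'⟩ := (overlapFree_iff w).1 hw 0 1 (by norm_num)
  obtain ⟨j, hj, hj'⟩ := (overlapFree_iff w).1 hw 1 2 (by norm_num)
  have e0 := h 0
  have e1 := h 1
  have ht : thueMorse 2 = 1 := by simp [thueMorse]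
  have h2 : ∀ a b : Fin 2, a ≠ b → a = 1 - b := by decide
  have h3 : ∀ a : Fin 2, a + 1 + 1 = a := by decide
  have v1 : v 1 = v 0 := by rw [hv 1, ht, h3]
  have hw1 : w 1 = 1 - v 0 := by
    rw [← e0.1]
    apply h2
    interval_cases i
    · exact absurd h01 hi'
    · exact hi'
  -- With `w 2 = a` the letters `w 1, …, w 5` are `b a b a b`, where `b` is the other letter.
  interval_cases j
  · exact hj' (hw1.trans e0.2.symm)
  · exact hj' (e0.1.trans (v1.symm.trans e1.1.symm))
  · exact hj' (e0.2.trans ((congrArg (1 - ·) v1.symm).trans e1.2.symm))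

/-- Desubstituting `w` repeatedly, either the prefix removed is nonempty at some level, or `w` is
the Thue–Morse word or its complement. -/
theorem OverlapFree.balanced_zero_or {w : ℕ → Fin 2} (hw : OverlapFree w) :
    Balanced 0 w ∨ ∀ n, w n = w 0 + thueMorse n := by
  by_contra! hc
  obtain ⟨hb, n, hn⟩ := hc
  have next : ∀ x : {x : ℕ → Fin 2 // OverlapFree x ∧ ¬ Balanced 0 x},
      ∃ y : {x : ℕ → Fin 2 // OverlapFree x ∧ ¬ Balanced 0 x}, IsExt 0 x.1 y.1 := by
    rintro ⟨x, hx, hxb⟩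
    obtain ⟨e, y, hy, hext, rfl | rfl | ⟨rfl, h01⟩⟩ := hx.exists_isExt
    · exact ⟨⟨y, hy, fun h => hxb (hext.balanced_even (by norm_num) h)⟩, hext⟩
    · exact absurd (hext.balanced_odd (m := 0) (by norm_num)) hxb
    · rcases hy.balanced_one_or with h | h
      · exact absurd (hext.balanced_even (by norm_num) h) hxb
      · exact absurd h (hx.not_shift hext h01)
  choose f hf using next
  let u : ℕ → {x : ℕ → Fin 2 // OverlapFree x ∧ ¬ Balanced 0 x} := fun j => f^[j] ⟨w, hw, hb⟩
  have hu : ∀ j, IsExt 0 (u j).1 (u (j + 1)).1 := by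
    intro j
    simp only [u, Function.iterate_succ_apply']
    exact hf _
  have heq : ∀ j, (u j).1 0 = (u (j + 1)).1 0 := fun j => (hu j 0).1
  have hall : ∀ n j, (u j).1 n = (u j).1 0 + thueMorse n := by
    intro n
    induction n using Nat.strong_induction_on with
    | _ n ih =>
      intro j
      rcases Nat.eq_zero_or_pos n with rfl | hpos
      · simp [thueMorse_zero]
      obtain ⟨m, hm⟩ : ∃ m, n = 2 * m ∨ n = 2 * m + 1 := ⟨n / 2, by omega⟩
      have h1 := hu j m
      rw [zero_add, ih m (by omega), ← heq] at h1
      rcases hm with rfl | rfl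
      · rw [h1.1, thueMorse_two_mul]
      · rw [h1.2, thueMorse_two_mul_add_one]
        have : ∀ a b : Fin 2, 1 - (a + b) = a + (1 - b) := by decide
        exact this _ _
  exact hn (hall n 0)

theorem OverlapFree.balanced {w : ℕ → Fin 2} (hw : OverlapFree w) (h : w ≠ thueMorse)
    (h' : w ≠ complement thueMorse) : Balanced 0 w := by
  refine hw.balanced_zero_or.resolve_right fun hall => ?_
  have h2 : ∀ a : Fin 2, a = 0 ∨ a = 1 := by decide
  rcases h2 (w 0) with h0 | h0
  · exact h (funext fun n => by rw [hall, h0, zero_add])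
  · refine h' (funext fun n => ?_)
    have : ∀ a : Fin 2, 1 + a = 1 - a := by decide
    rw [hall, h0, this, complement]

/-! ### Densities -/

open Filter Topology

theorem SD_take (w : ℕ → Fin 2) (n : ℕ) :
    SD (take w n) (take thueMorse n) = (matchCount 0 w n : ℝ) / n := by
  change (1 / (n : ℝ)) * ∑ i : Fin n, (if w i = thueMorse i then (1 : ℝ) else 0) = _
  rw [Fin.sum_univ_eq_sum_range (fun i => if w i = thueMorse i then (1 : ℝ) else 0)]
  simp only [matchCount, add_zero]
  push_cast
  ring

theorem SD_take_mem (w : ℕ → Fin 2) (n : ℕ) :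
    SD (take w n) (take thueMorse n) ∈ Set.Icc (0 : ℝ) 1 := by
  rw [SD_take]
  have h := (matchCount_add_le 0 w 0 n).2
  simp only [matchCount_zero, zero_add] at h
  exact ⟨by positivity, div_le_one_of_le₀ (by exact_mod_cast h) (by positivity)⟩

theorem Balanced.bounds {w : ℕ → Fin 2} (h : Balanced 0 w) :
    1 / 4 ≤ LSD w thueMorse ∧ LSD w thueMorse ≤ USD w thueMorse ∧ USD w thueMorse ≤ 3 / 4 := by
  obtain ⟨C, hC⟩ := h
  have hle : IsBoundedUnder (· ≤ ·) atTop fun n => SD (take w n) (take thueMorse n) :=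
    isBoundedUnder_of ⟨1, fun n => (SD_take_mem w n).2⟩
  have hge : IsBoundedUnder (· ≥ ·) atTop fun n => SD (take w n) (take thueMorse n) :=
    isBoundedUnder_of ⟨0, fun n => (SD_take_mem w n).1⟩
  have h0 : Tendsto (fun n : ℕ => (C : ℝ) / 4 / n) atTop (𝓝 0) :=
    tendsto_const_div_atTop_nhds_zero_nat _
  have hlow : Tendsto (fun n : ℕ => 1 / 4 - (C : ℝ) / 4 / n) atTop (𝓝 (1 / 4)) := by
    simpa only [sub_zero] using h0.const_sub (1 / 4)
  have hupp : Tendsto (fun n : ℕ => 3 / 4 + (C : ℝ) / 4 / n) atTop (𝓝 (3 / 4)) := by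
    simpa only [add_zero] using h0.const_add (3 / 4)
  refine ⟨?_, liminf_le_limsup hle hge, ?_⟩
  · rw [← hlow.liminf_eq]
    refine liminf_le_liminf ?_ hlow.isBoundedUnder_ge hle.isCoboundedUnder_ge
    filter_upwards [eventually_gt_atTop 0] with n hn
    have hn' : (0 : ℝ) < n := by exact_mod_cast hn
    have := (hC n).1
    have h1 : (n : ℝ) ≤ 4 * matchCount 0 w n + C := by exact_mod_cast this
    rw [SD_take, sub_le_iff_le_add, ← add_div, le_div_iff₀ hn']
    linarith
  · rw [← hupp.limsup_eq]
    refine limsup_le_limsup ?_ hge.isCoboundedUnder_le hupp.isBoundedUnder_le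
    filter_upwards [eventually_gt_atTop 0] with n hn
    have hn' : (0 : ℝ) < n := by exact_mod_cast hn
    have := (hC n).2
    have h1 : 4 * (matchCount 0 w n : ℝ) ≤ 3 * n + C := by exact_mod_cast this
    rw [SD_take, ← sub_le_iff_le_add, div_sub_div_same, div_le_iff₀ hn']
    linarith

theorem matchCount_flipOn (A : Set ℕ) (n : ℕ) :
    matchCount 0 (flipOn A thueMorse) n + (A ∩ Set.Iio n).ncard = n := by
  classical
  have hcard : (A ∩ Set.Iio n).ncard = ∑ i ∈ Finset.range n, if i ∈ A then 1 else 0 := by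
    rw [← Finset.card_filter, ← Set.ncard_coe_finset]
    congr 1
    ext i
    simp [and_comm]
  rw [hcard, matchCount, ← Finset.sum_add_distrib]
  have h2 : ∀ a : Fin 2, 1 - a ≠ a := by decide
  rw [Finset.sum_congr rfl (g := fun _ => 1)]
  · simp
  · intro i _
    by_cases hi : i ∈ A <;> simp [flipOn, hi, h2]

theorem USD_flipOn {A : Set ℕ} (hA : HasDensity A 0) : USD (flipOn A thueMorse) thueMorse = 1 := by
  apply Tendsto.limsup_eq
  have h1 : Tendsto (fun n : ℕ => 1 - ((A ∩ Set.Iio n).ncard : ℝ) / n) atTop (𝓝 1) := by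
    simpa using Tendsto.const_sub 1 hA
  refine h1.congr' ?_
  filter_upwards [eventually_gt_atTop 0] with n hn
  have hn' : (n : ℝ) ≠ 0 := by exact_mod_cast hn.ne'
  have h2 : (matchCount 0 (flipOn A thueMorse) n : ℝ) + (A ∩ Set.Iio n).ncard = n := by
    exact_mod_cast matchCount_flipOn A n
  rw [SD_take, eq_div_iff hn', sub_mul, div_mul_cancel₀ _ hn']
  linarith

end InfWord

theorem mainTheorem1 :
    (∀ w : ℕ → Fin 2, InfWord.OverlapFree w → w ≠ InfWord.thueMorse →
      w ≠ InfWord.complement InfWord.thueMorse →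
      1 / 4 ≤ InfWord.LSD w InfWord.thueMorse ∧
      InfWord.LSD w InfWord.thueMorse ≤ InfWord.USD w InfWord.thueMorse ∧
      InfWord.USD w InfWord.thueMorse ≤ 3 / 4) ∧
    (∀ A : Set ℕ, A.Infinite → InfWord.HasDensity A 0 →
      ¬ InfWord.OverlapFree (InfWord.flipOn A InfWord.thueMorse)) := by
  refine ⟨fun w hw h h' => (hw.balanced h h').bounds, fun A hinf hA hw => ?_⟩
  have h2 : ∀ a : Fin 2, 1 - a ≠ a := by decide
  have hU := InfWord.USD_flipOn hA
  by_cases hc : InfWord.flipOn A InfWord.thueMorse = InfWord.complement InfWord.thueMorse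
  · -- Agreement has density one for the flipped word but never occurs for the complement.
    have hz : ∀ n, InfWord.SD (InfWord.take (InfWord.complement InfWord.thueMorse) n)
        (InfWord.take InfWord.thueMorse n) = 0 := by
      intro n
      simp [InfWord.SD, InfWord.take, InfWord.complement, h2]
    rw [hc, InfWord.USD] at hU
    simp [hz] at hU
  · have ht : InfWord.flipOn A InfWord.thueMorse ≠ InfWord.thueMorse := by
      intro h
      obtain ⟨n, hn⟩ := hinf.nonempty
      have := congrFun h n
      simp [InfWord.flipOn, hn, h2] at this
    have := (hw.balanced ht hc).bounds.2.2
    rw [hU] at this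
    norm_num at this
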